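/- Let $k,m,n\ge 1$, let $X_1,\ldots,X_k$ be complex $m\times n$ matrices, and let $Z_1,\ldots,Z_k$ be contractions in $\mathbb{M}_m$, that is, complex $m\times m$ matrices with operator norm (for the Euclidean norm on $\mathbb{C}^m$) at most $1$. Then $$ \left|\sum_{i=1}^k X_i^*Z_iX_i\right| \prec_{w\!\log} \sum_{i=1}^k X_i^*X_i . $$ Here $|A|=(A^*A)^{1/2}$ and, for positive semidefinite $n\times n$ matrices $A$ and $B$ with eigenvalues $\lambda_1(\cdot)\ge\cdots\ge\lambda_n(\cdot)$ counted with multiplicity, the weak log-majorisation $A\prec_{w\!\log}B$ means that $$ \prod_{j=1}^r\lambda_j(A)\le\prod_{j=1}^r\lambda_j(B)\qquad\text{for all } r=1,\ldots,n . $$ -/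

import Mathlib

open scoped MatrixOrder ComplexOrder Matrix

/-- A square complex matrix is a contraction if its operator norm, for the Euclidean norm
on column vectors, is at most one. -/
def Matrix.IsContraction {m : Type*} [Fintype m] [DecidableEq m] (Z : Matrix m m ℂ) : Prop :=
  ‖Matrix.toEuclideanCLM (n := m) (𝕜 := ℂ) Z‖ ≤ 1

/-- The absolute value `|A| = (Aᴴ A)^{1/2}` of a square complex matrix: the unique positive
semidefinite square root of `Aᴴ A`. -/
noncomputable def Matrix.absoluteValue {n : Type*} [Fintype n] [DecidableEq n]
    (A : Matrix n n ℂ) : Matrix n n ℂ :=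
  CFC.sqrt (Aᴴ * A)

/-- Weak log-majorisation of positive semidefinite matrices: for every `r`, the product of the
`r` largest eigenvalues (with multiplicity) of `A` is at most that of `B`.
Here `eigenvalues₀` lists the eigenvalues with multiplicity in decreasing order. -/
def Matrix.WeakLogMajorizedBy {n : Type*} [Fintype n] [DecidableEq n]
    (A B : Matrix n n ℂ) : Prop :=
  ∃ (hA : A.PosSemidef) (hB : B.PosSemidef), ∀ r : ℕ, 1 ≤ r → r ≤ Fintype.card n →
    ∏ j : Fin (Fintype.card n) with j.val < r, hA.isHermitian.eigenvalues₀ j ≤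
      ∏ j : Fin (Fintype.card n) with j.val < r, hB.isHermitian.eigenvalues₀ j

namespace Matrix

variable {n m ι : Type*} [Fintype n] [DecidableEq n] [Fintype m] [DecidableEq m]
  [Fintype ι] [DecidableEq ι]

/-! Write `S = ∑ Xᵢᴴ Zᵢ Xᵢ` and `B = ∑ Xᵢᴴ Xᵢ`. Contractivity makes each block matrix `[1, Zᵢ; Zᵢᴴ,
1]` positive; conjugating by `Xᵢ ⊕ Xᵢ` and summing gives `[B, S; Sᴴ, B] ≥ 0`. Let the columns of `V`
be orthonormal eigenvectors of `|S|` for its `r` largest eigenvalues, `D` their diagonal matrix, and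
`W = S V`, so `Wᴴ W = D²`. Compressing by `W ⊕ V` leaves diagonal blocks `Wᴴ B W`, `Vᴴ B V` and
off-diagonal block `D²`. With `p`, `q` the products of the `r` largest eigenvalues of `|S|` and `B`,
`det_mul_star_det_le` and `det_conjTranspose_mul_mul_le` give `p⁴ ≤ (p² q) q`, hence `p ≤ q`. -/

lemma PosSemidef.one_le_det_one_add {H : Matrix n n ℂ} (hH : H.PosSemidef) :
    1 ≤ (1 + H).det := by
  have h := hH.1.spectral_theorem
  rw [Unitary.conjStarAlgAut_apply] at h
  set U := hH.1.eigenvectorUnitary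
  have hU : (U : Matrix n n ℂ) * star (U : Matrix n n ℂ) = 1 := Unitary.coe_mul_star_self U
  have h1 : 1 + H = (U : Matrix n n ℂ) *
      (1 + diagonal (RCLike.ofReal ∘ hH.1.eigenvalues)) * star (U : Matrix n n ℂ) := by
    rw [mul_add, add_mul, mul_one, hU, ← h]
  have h2 : (1 + H).det = ((∏ i, (1 + hH.1.eigenvalues i) : ℝ) : ℂ) := by
    rw [h1, det_mul_right_comm, hU, one_mul, ← diagonal_one, diagonal_add, det_diagonal]
    simp
  rw [h2]
  have h3 : (1 : ℝ) ≤ ∏ i, (1 + hH.1.eigenvalues i) :=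
    Finset.one_le_prod fun i _ => by linarith [hH.eigenvalues_nonneg i]
  exact_mod_cast h3

lemma PosSemidef.det_le_det_add {A C : Matrix n n ℂ} (hA : A.PosSemidef) (hC : C.PosSemidef) :
    A.det ≤ (A + C).det := by
  by_cases h : A.det = 0
  · rw [h]; exact (hA.add hC).det_nonneg
  · obtain ⟨S, rfl⟩ : ∃ S : Matrix n n ℂ, A = Sᴴ * S :=
      CStarAlgebra.nonneg_iff_eq_star_mul_self.mp hA.nonneg
    have hS : IsUnit S.det := by
      rw [isUnit_iff_ne_zero]
      rintro h0
      exact h (by rw [det_mul, h0, mul_zero])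
    have h1 : Sᴴ * S + C = Sᴴ * (1 + (S⁻¹)ᴴ * C * S⁻¹) * S := by
      have e1 : S⁻¹ * S = 1 := nonsing_inv_mul _ hS
      have e2 : Sᴴ * (S⁻¹)ᴴ = 1 := by rw [← conjTranspose_mul, e1, conjTranspose_one]
      calc Sᴴ * S + C = Sᴴ * S + (Sᴴ * (S⁻¹)ᴴ) * C * (S⁻¹ * S) := by rw [e1, e2]; simp
        _ = _ := by noncomm_ring
    have h2 := (hC.conjTranspose_mul_mul_same S⁻¹).one_le_det_one_add
    have h3 : (Sᴴ * S + C).det = (Sᴴ * S).det * (1 + (S⁻¹)ᴴ * C * S⁻¹).det := by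
      rw [h1, det_mul, det_mul, det_mul]; ring
    rw [h3]
    exact le_mul_of_one_le_right hA.det_nonneg h2

lemma PosSemidef.det_le_det {A B : Matrix n n ℂ} (hA : A.PosSemidef)
    (hAB : (B - A).PosSemidef) : A.det ≤ B.det := by
  simpa using hA.det_le_det_add hAB

/-- For invertible `A`, the Schur complement gives `Cᴴ A⁻¹ C ≤ D`, and determinants are monotone. -/
lemma PosSemidef.det_mul_star_det_le {A C D : Matrix n n ℂ}
    (h : (fromBlocks A C Cᴴ D).PosSemidef) : C.det * star C.det ≤ A.det * D.det := by
  have hA : A.PosSemidef := h.submatrix Sum.inl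
  have hD : D.PosSemidef := h.submatrix Sum.inr
  by_cases hA0 : A.det = 0
  · obtain ⟨x, hx, hAx⟩ := exists_mulVec_eq_zero_iff.mpr hA0
    -- The quadratic form vanishes at `x ⊕ 0`, so positivity puts this vector in the kernel; its
    -- lower block gives `Cᴴ x = 0`.
    have h1 := (h.dotProduct_mulVec_zero_iff (Sum.elim x 0)).mp (by
      simp [fromBlocks_mulVec, hAx, dotProduct])
    have h2 : Cᴴ *ᵥ x = 0 := by
      ext i
      simpa [fromBlocks_mulVec] using congrFun h1 (Sum.inr i)
    have h3 : Cᴴ.det = 0 := exists_mulVec_eq_zero_iff.mp ⟨x, hx, h2⟩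
    rw [← det_conjTranspose, h3, hA0]; simp
  · have hA' : A.PosDef := hA.posDef_iff_det_ne_zero.mpr hA0
    have := hA'.isUnit.invertible
    have h1 := (PosDef.fromBlocks₁₁ C D hA').mp h
    have h2 := (hA'.inv.posSemidef.conjTranspose_mul_mul_same C).det_le_det h1
    have h3 := mul_le_mul_of_nonneg_left h2 hA.det_nonneg
    refine le_of_eq_of_le ?_ h3
    rw [det_mul, det_mul, det_conjTranspose, det_nonsing_inv, Ring.inverse_eq_inv']
    field_simp

lemma IsContraction.posSemidef_one_sub {Z : Matrix m m ℂ} (hZ : Z.IsContraction) :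
    (1 - Zᴴ * Z).PosSemidef := by
  refine .of_dotProduct_mulVec_nonneg
    (isHermitian_one.sub (isHermitian_conjTranspose_mul_self Z)) fun x => ?_
  have h1 : ‖WithLp.toLp 2 (Z *ᵥ x)‖ ≤ ‖WithLp.toLp 2 x‖ := by
    have := (toEuclideanCLM (n := m) (𝕜 := ℂ) Z).le_of_opNorm_le hZ (WithLp.toLp 2 x)
    rwa [toEuclideanCLM_toLp, one_mul] at this
  have h2 (y : m → ℂ) : star y ⬝ᵥ y = ((‖WithLp.toLp 2 y‖ ^ 2 : ℝ) : ℂ) := by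
    have := inner_self_eq_norm_sq_to_K (𝕜 := ℂ) (WithLp.toLp 2 y)
    rw [EuclideanSpace.inner_toLp_toLp, dotProduct_comm] at this
    simpa using this
  have h3 : star x ⬝ᵥ ((1 - Zᴴ * Z) *ᵥ x) = star x ⬝ᵥ x - star (Z *ᵥ x) ⬝ᵥ (Z *ᵥ x) := by
    rw [sub_mulVec, one_mulVec, dotProduct_sub, ← mulVec_mulVec, star_mulVec,
      ← dotProduct_mulVec]
  rw [h3, h2, h2, sub_nonneg]
  exact_mod_cast pow_le_pow_left₀ (norm_nonneg _) h1 2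

lemma IsContraction.posSemidef_fromBlocks {l : Type*} [Fintype l] {Z : Matrix m m ℂ}
    (hZ : Z.IsContraction) (X : Matrix m l ℂ) :
    (fromBlocks (Xᴴ * X) (Xᴴ * Z * X) (Xᴴ * Z * X)ᴴ (Xᴴ * X)).PosSemidef := by
  have h1 : (fromBlocks 1 Z Zᴴ 1).PosSemidef := by
    have := invertibleOne (α := Matrix m m ℂ)
    rw [PosDef.fromBlocks₁₁ Z 1 PosDef.one]
    simpa using hZ.posSemidef_one_sub
  convert h1.conjTranspose_mul_mul_same (fromBlocks X 0 0 X) using 1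
  simp [fromBlocks_conjTranspose, fromBlocks_multiply, Matrix.mul_assoc]

/-- For invertible `Wᴴ W` and `K = diag(√g)`, Sylvester's identity turns the ratio of determinants
into `det (1 + K P K)`, where `P = W (Wᴴ W)⁻¹ Wᴴ` is a projection. Since `P ≤ 1`, this is at most
`det (1 + K²)`. -/
lemma det_conjTranspose_mul_diagonal_one_add_mul_le (g : n → ℝ) (hg : ∀ i, 0 ≤ g i)
    (W : Matrix n ι ℂ) :
    (Wᴴ * diagonal (fun i => ((1 + g i : ℝ) : ℂ)) * W).det ≤
      (Wᴴ * W).det * ((∏ i, (1 + g i) : ℝ) : ℂ) := by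
  have hM := posSemidef_conjTranspose_mul_self W
  by_cases h0 : (Wᴴ * W).det = 0
  · obtain ⟨x, hx, hWx⟩ := exists_mulVec_eq_zero_iff.mpr h0
    rw [conjTranspose_mul_self_mulVec_eq_zero] at hWx
    have h : (Wᴴ * diagonal (fun i => ((1 + g i : ℝ) : ℂ)) * W).det = 0 :=
      exists_mulVec_eq_zero_iff.mp ⟨x, hx, by rw [← mulVec_mulVec, hWx, mulVec_zero]⟩
    rw [h, h0, zero_mul]
  have hM' : (Wᴴ * W).PosDef := hM.posDef_iff_det_ne_zero.mpr h0
  have := hM'.isUnit.invertible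
  have hproj : (1 - W * (Wᴴ * W)⁻¹ * Wᴴ).PosSemidef := by
    -- The complement of the lower block is zero; that of the upper block is `1 - P`.
    have h1 : (fromBlocks (Wᴴ * W) Wᴴ Wᴴᴴ 1).PosSemidef := by
      have := invertibleOne (α := Matrix n n ℂ)
      rw [PosDef.fromBlocks₂₂ _ _ PosDef.one]
      simpa using PosSemidef.zero
    simpa using (PosDef.fromBlocks₁₁ Wᴴ 1 hM').mp h1
  set M := Wᴴ * W
  set K : Matrix n n ℂ := diagonal (fun i => (√(g i) : ℂ))
  have hK : Kᴴ = K := by simp [K, diagonal_conjTranspose, Pi.star_def]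
  have hKK : K * K = diagonal (fun i => (g i : ℂ)) := by
    rw [diagonal_mul_diagonal]
    congr 1; ext i
    exact_mod_cast Real.mul_self_sqrt (hg i)
  have hsum : diagonal (fun i => ((1 + g i : ℝ) : ℂ)) = 1 + K * K := by
    rw [hKK, ← diagonal_one, diagonal_add]; simp
  have e1 : M * M⁻¹ = 1 := mul_inv_of_invertible M
  have h1 : Wᴴ * (1 + K * K) * W = M * (1 + (M⁻¹ * Wᴴ * K) * (K * W)) := by
    calc Wᴴ * (1 + K * K) * W = M + 1 * (Wᴴ * K * K * W) := by
          simp only [M, Matrix.mul_add, Matrix.add_mul, Matrix.mul_one, Matrix.mul_assoc,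
            Matrix.one_mul]
      _ = _ := by
          rw [Matrix.mul_add, Matrix.mul_one, ← e1]
          simp only [Matrix.mul_assoc]
  have h2 : (1 + (K * W) * (M⁻¹ * Wᴴ * K)).det ≤ (1 + K * K).det := by
    refine PosSemidef.det_le_det (PosSemidef.one.add ?_) ?_
    · have := hM'.inv.posSemidef.mul_mul_conjTranspose_same (K * W)
      rw [conjTranspose_mul, hK] at this
      simpa only [Matrix.mul_assoc] using this
    · convert hproj.conjTranspose_mul_mul_same K using 1
      rw [hK, Matrix.mul_sub, Matrix.sub_mul, Matrix.mul_one, add_sub_add_left_eq_sub]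
      simp only [Matrix.mul_assoc]
  have h3 : ((∏ i, (1 + g i) : ℝ) : ℂ) = (1 + K * K).det := by
    rw [← hsum, det_diagonal]; simp
  rw [h3, hsum, h1, det_mul, det_one_add_mul_comm]
  exact mul_le_mul_of_nonneg_left h2 hM.det_nonneg

/-- Dominate `d` by `c (1 + g)` with `g` supported on `T`. The scalar contributes one factor `c` per
column of `W`, which `T.card` matches exactly. -/
lemma det_conjTranspose_mul_diagonal_mul_le_prod_max {d : n → ℝ} (hd : ∀ i, 0 ≤ d i)
    {T : Finset n} (hT : T.card = Fintype.card ι) {c : ℝ} (hc : 0 < c)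
    (hcT : ∀ i ∉ T, d i ≤ c) (W : Matrix n ι ℂ) :
    (Wᴴ * diagonal (fun i => (d i : ℂ)) * W).det ≤
      (Wᴴ * W).det * ((∏ i ∈ T, max (d i) c : ℝ) : ℂ) := by
  set g : n → ℝ := fun i => if i ∈ T then max (d i) c / c - 1 else 0 with hgdef
  have hg i : 0 ≤ g i := by
    simp only [hgdef]
    split_ifs
    · rw [sub_nonneg, one_le_div hc]; exact le_max_right _ _
    · rfl
  have hdg i : d i ≤ c * (1 + g i) := by
    simp only [hgdef]
    split_ifs with h
    · rw [add_sub_cancel, mul_div_cancel₀ _ hc.ne']; exact le_max_left _ _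
    · simpa using hcT i h
  have hprod : c ^ Fintype.card ι * ∏ i, (1 + g i) = ∏ i ∈ T, max (d i) c := by
    have h1 : ∏ i, (1 + g i) = ∏ i ∈ T, (max (d i) c / c) := by
      rw [← Finset.prod_subset (Finset.subset_univ T)]
      · refine Finset.prod_congr rfl fun i hi => ?_
        simp [hgdef, hi]
      · intro i _ hi
        simp [hgdef, hi]
    rw [h1, ← hT, ← Finset.prod_const, ← Finset.prod_mul_distrib]
    exact Finset.prod_congr rfl fun i _ => mul_div_cancel₀ _ hc.ne'
  have h1 : (Wᴴ * diagonal (fun i => (d i : ℂ)) * W).det ≤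
      (Wᴴ * diagonal (fun i => ((c * (1 + g i) : ℝ) : ℂ)) * W).det := by
    refine PosSemidef.det_le_det (.conjTranspose_mul_mul_same ?_ W) ?_
    · rw [posSemidef_diagonal_iff]; exact fun i => by exact_mod_cast hd i
    · rw [← Matrix.sub_mul, ← Matrix.mul_sub, diagonal_sub]
      refine .conjTranspose_mul_mul_same ?_ W
      rw [posSemidef_diagonal_iff]
      intro i
      rw [sub_nonneg]
      exact_mod_cast hdg i
  have h2 : Wᴴ * diagonal (fun i => ((c * (1 + g i) : ℝ) : ℂ)) * W =
      (c : ℂ) • (Wᴴ * diagonal (fun i => ((1 + g i : ℝ) : ℂ)) * W) := by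
    rw [← Matrix.smul_mul, ← Matrix.mul_smul, ← diagonal_smul]
    congr 3; ext i; simp
  have h3 := mul_le_mul_of_nonneg_left (det_conjTranspose_mul_diagonal_one_add_mul_le g hg W)
    (show (0 : ℂ) ≤ (c : ℂ) ^ Fintype.card ι by exact_mod_cast pow_nonneg hc.le _)
  rw [h2, det_smul] at h1
  refine (h1.trans h3).trans_eq ?_
  rw [← hprod]; push_cast; ring

/-- Let `c` decrease to the minimum of `d` on `T`; the `ε` keeps `c` positive when that minimum is
zero. -/
lemma det_conjTranspose_mul_diagonal_mul_le {d : n → ℝ} (hd : ∀ i, 0 ≤ d i)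
    {T : Finset n} (hT : T.card = Fintype.card ι) (hdT : ∀ i ∈ T, ∀ j ∉ T, d j ≤ d i)
    (W : Matrix n ι ℂ) :
    (Wᴴ * diagonal (fun i => (d i : ℂ)) * W).det ≤
      (Wᴴ * W).det * ((∏ i ∈ T, d i : ℝ) : ℂ) := by
  rcases T.eq_empty_or_nonempty with rfl | hne
  · have : IsEmpty ι := Fintype.card_eq_zero_iff.mp (by simpa using hT.symm)
    simp
  obtain ⟨i₀, hi₀, hmin⟩ := T.exists_min_image d hne
  have hlim : Filter.Tendsto (fun ε : ℝ => (Wᴴ * W).det *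
      ((∏ i ∈ T, max (d i) (d i₀ + ε) : ℝ) : ℂ)) (nhdsWithin 0 (Set.Ioi 0))
      (nhds ((Wᴴ * W).det * ((∏ i ∈ T, d i : ℝ) : ℂ))) := by
    have h1 : Continuous (fun ε : ℝ => (Wᴴ * W).det *
      ((∏ i ∈ T, max (d i) (d i₀ + ε) : ℝ) : ℂ)) := by fun_prop
    have h2 := (h1.tendsto 0).mono_left (nhdsWithin_le_nhds (s := Set.Ioi 0))
    rwa [add_zero, Finset.prod_congr rfl fun i hi => max_eq_left (hmin i hi)] at h2
  refine ge_of_tendsto hlim (Filter.eventually_of_mem self_mem_nhdsWithin fun ε hε => ?_)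
  exact det_conjTranspose_mul_diagonal_mul_le_prod_max hd hT
    (add_pos_of_nonneg_of_pos (hd i₀) hε)
    (fun j hj => (hdT i₀ hi₀ j hj).trans (le_add_of_nonneg_right (le_of_lt hε))) W

/-- The indices of the `r` largest eigenvalues of a Hermitian matrix. -/
noncomputable def topIndices (n : Type*) [Fintype n] [DecidableEq n] (r : ℕ) : Finset n :=
  {j | ((Fintype.equivOfCardEq (Fintype.card_fin (Fintype.card n))).symm j :
    Fin (Fintype.card n)).val < r}

lemma IsHermitian.prod_topIndices {A : Matrix n n ℂ} (hA : A.IsHermitian) (r : ℕ) :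
    ∏ j ∈ topIndices n r, hA.eigenvalues j =
      ∏ j : Fin (Fintype.card n) with j.val < r, hA.eigenvalues₀ j := by
  refine Finset.prod_equiv (Fintype.equivOfCardEq (Fintype.card_fin _)).symm ?_ ?_
  · simp [topIndices]
  · intro i _; rfl

lemma IsHermitian.eigenvalues_le_of_topIndices {A : Matrix n n ℂ} (hA : A.IsHermitian) {r : ℕ}
    {i j : n} (hi : i ∈ topIndices n r) (hj : j ∉ topIndices n r) :
    hA.eigenvalues j ≤ hA.eigenvalues i := by
  simp only [topIndices, Finset.mem_filter, Finset.mem_univ, true_and, not_lt] at hi hj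
  exact hA.eigenvalues₀_antitone (Fin.le_def.mpr (hi.le.trans hj))

lemma PosSemidef.det_conjTranspose_mul_mul_le {B : Matrix n n ℂ} (hB : B.PosSemidef) {r : ℕ}
    (hr : (topIndices n r).card = Fintype.card ι) (W : Matrix n ι ℂ) :
    (Wᴴ * B * W).det ≤
      (Wᴴ * W).det * ((∏ j ∈ topIndices n r, hB.1.eigenvalues j : ℝ) : ℂ) := by
  have h := hB.1.spectral_theorem
  rw [Unitary.conjStarAlgAut_apply] at h
  set U : Matrix n n ℂ := ↑hB.1.eigenvectorUnitary
  have hU : U * Uᴴ = 1 := Unitary.coe_mul_star_self hB.1.eigenvectorUnitary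
  have h1 := det_conjTranspose_mul_diagonal_mul_le hB.eigenvalues_nonneg hr
    (fun i hi j hj => hB.1.eigenvalues_le_of_topIndices hi hj) (Uᴴ * W)
  have h2 : (Uᴴ * W)ᴴ * (Uᴴ * W) = Wᴴ * W := by
    rw [conjTranspose_mul, conjTranspose_conjTranspose, Matrix.mul_assoc, ← Matrix.mul_assoc U,
      hU, Matrix.one_mul]
  have h3 : (Uᴴ * W)ᴴ * diagonal (fun i => (hB.1.eigenvalues i : ℂ)) * (Uᴴ * W) =
      Wᴴ * B * W := by
    conv_rhs => rw [h]
    rw [conjTranspose_mul, conjTranspose_conjTranspose]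
    simp only [Matrix.mul_assoc]
    rfl
  rwa [h2, h3] at h1

lemma IsHermitian.mul_eigenvectorUnitary_submatrix {A : Matrix n n ℂ} (hA : A.IsHermitian)
    (f : ι → n) :
    A * (hA.eigenvectorUnitary : Matrix n n ℂ).submatrix id f =
      (hA.eigenvectorUnitary : Matrix n n ℂ).submatrix id f *
        diagonal (fun i => (hA.eigenvalues (f i) : ℂ)) := by
  ext a i
  rw [mul_diagonal]
  have := congrFun (hA.mulVec_eigenvectorBasis (f i)) a
  simp only [Pi.smul_apply, Complex.real_smul] at this
  rw [submatrix_apply, id, eigenvectorUnitary_apply, mul_comm, ← this]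
  rfl

/-- A positive semidefinite block matrix with diagonal blocks `B` and off-diagonal block `S`
forces the weak log-majorisation of `|S|` by `B`. -/
lemma PosSemidef.weakLogMajorizedBy_absoluteValue {B S : Matrix n n ℂ}
    (h : (fromBlocks B S Sᴴ B).PosSemidef) : S.absoluteValue.WeakLogMajorizedBy B := by
  have hB : B.PosSemidef := h.submatrix Sum.inl
  have hM : S.absoluteValue.PosSemidef := nonneg_iff_posSemidef.mp (CFC.sqrt_nonneg _)
  refine ⟨hM, hB, fun r _ _ => ?_⟩
  rw [← IsHermitian.prod_topIndices, ← IsHermitian.prod_topIndices]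
  have hMM : S.absoluteValue * S.absoluteValue = Sᴴ * S :=
    CFC.sqrt_mul_sqrt_self _ (posSemidef_conjTranspose_mul_self S).nonneg
  set M := S.absoluteValue
  set p := ∏ j ∈ topIndices n r, hM.isHermitian.eigenvalues j with hp
  set q := ∏ j ∈ topIndices n r, hB.isHermitian.eigenvalues j with hq
  have hp0 : 0 ≤ p := Finset.prod_nonneg fun i _ => hM.eigenvalues_nonneg i
  have hq0 : 0 ≤ q := Finset.prod_nonneg fun i _ => hB.eigenvalues_nonneg i
  set V : Matrix n (topIndices n r) ℂ :=
    (hM.1.eigenvectorUnitary : Matrix n n ℂ).submatrix id Subtype.val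
  set D : Matrix (topIndices n r) (topIndices n r) ℂ :=
    diagonal (fun i => (hM.1.eigenvalues i : ℂ))
  have hMV : M * V = V * D := hM.1.mul_eigenvectorUnitary_submatrix _
  have hVV : Vᴴ * V = 1 := by
    have h1 : (hM.1.eigenvectorUnitary : Matrix n n ℂ)ᴴ * hM.1.eigenvectorUnitary = 1 :=
      Unitary.coe_star_mul_self hM.1.eigenvectorUnitary
    ext i j
    have := congrFun (congrFun h1 i) j
    rw [one_apply] at this ⊢
    simp only [Subtype.ext_iff]
    exact this
  have hD : Dᴴ = D := by simp [D, diagonal_conjTranspose, Pi.star_def]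
  have hdetD : D.det = (p : ℂ) := by
    rw [det_diagonal, hp, Complex.ofReal_prod]
    exact Finset.prod_coe_sort _ fun i => (hM.1.eigenvalues i : ℂ)
  -- Leaving these columns unnormalised avoids dividing by singular values, which may vanish.
  set W := S * V
  have hWW : Wᴴ * W = D * D := by
    calc Wᴴ * W = Vᴴ * (Sᴴ * S) * V := by
          simp only [W, conjTranspose_mul, Matrix.mul_assoc]
      _ = (M * V)ᴴ * (M * V) := by
          rw [← hMM, conjTranspose_mul, hM.1.eq]; simp only [Matrix.mul_assoc]
      _ = D * (Vᴴ * V) * D := by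
          rw [hMV, conjTranspose_mul, hD]; simp only [Matrix.mul_assoc]
      _ = D * D := by rw [hVV, Matrix.mul_one]
  have hblock : (fromBlocks (Wᴴ * B * W) (Wᴴ * W) (Wᴴ * W)ᴴ (Vᴴ * B * V)).PosSemidef := by
    convert h.conjTranspose_mul_mul_same (fromBlocks W 0 0 V) using 1
    simp [fromBlocks_conjTranspose, fromBlocks_multiply, W, Matrix.mul_assoc]
  have hcard : (topIndices n r).card = Fintype.card (topIndices n r) :=
    (Fintype.card_coe _).symm
  have h1 := hblock.det_mul_star_det_le
  have h2 := hB.det_conjTranspose_mul_mul_le hcard W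
  have h3 := hB.det_conjTranspose_mul_mul_le hcard V
  have h4 := h1.trans (mul_le_mul h2 h3 (hB.conjTranspose_mul_mul_same V).det_nonneg
    (mul_nonneg (posSemidef_conjTranspose_mul_self W).det_nonneg (by exact_mod_cast hq0)))
  rw [hWW, hVV, det_mul, det_one, hdetD, one_mul] at h4
  have h5 : p * p * (p * p) ≤ p * p * q * q := by
    have : star ((p : ℂ) * p) = (p : ℂ) * p := by simp
    rw [this] at h4
    exact_mod_cast h4
  rcases hp0.eq_or_lt with h0 | h0
  · rw [← h0]; exact hq0
  · have h6 : p * p ≤ q * q := by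
      rw [mul_assoc (p * p)] at h5
      exact le_of_mul_le_mul_left h5 (mul_pos h0 h0)
    exact abs_le_of_sq_le_sq' (by nlinarith) hq0 |>.2

end Matrix

theorem corollary3p3 (k m n : ℕ) (X : Fin k → Matrix (Fin m) (Fin n) ℂ)
    (Z : Fin k → Matrix (Fin m) (Fin m) ℂ) (hZ : ∀ i, (Z i).IsContraction) :
    (Matrix.absoluteValue (∑ i, (X i)ᴴ * Z i * X i)).WeakLogMajorizedBy
      (∑ i, (X i)ᴴ * X i) := by
  refine Matrix.PosSemidef.weakLogMajorizedBy_absoluteValue ?_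
  convert Matrix.posSemidef_sum Finset.univ fun i _ => (hZ i).posSemidef_fromBlocks (X i) using 1
  have h1 : (∑ i, (X i)ᴴ * Z i * X i)ᴴ = ∑ i, ((X i)ᴴ * Z i * X i)ᴴ :=
    Matrix.conjTranspose_sum _ _
  rw [h1]
  ext (a | a) (b | b) <;> simp [Matrix.sum_apply]
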